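/- Let $n\ge 3$, let $(N,h)$ be a nonempty smooth Riemannian manifold of dimension $n-1$ (without boundary), let $I\subset\mathbb R$ be a nonempty open interval, and let $r$ be a smooth positive function on $I$. Consider the warped product metric $g=ds^2+r^2h$ on $M=I\times N$. Let $R$ be a real constant and let $\lambda=\lambda(s)$ be a smooth function on $I$, regarded also as a function on $M$ that depends only on $s\in I$. Then $g$ has constant scalar curvature $R$ and satisfies $$-(\Delta_g\lambda)\,g+\nabla^2_g\lambda-\lambda\,\mathrm{Ric}(g)=g\quad\text{on } M$$ if and only if both of the following hold. (i) There are constants $\kappa_0,a\in\mathbb R$ such that $(N,h)$ is Einstein with $\mathrm{Ric}(h)=(n-2)\kappa_0h$, and on $I$ $$r''+\frac{R}{n(n-1)}\,r=a\,r^{1-n},\qquad (r')^2+\frac{R}{n(n-1)}\,r^2+\frac{2a}{n-2}\,r^{2-n}=\kappa_0 .$$ (ii) On $I$, $$r'\lambda'-r''\lambda=-\frac{1}{n-1}\,r .$$ Here $'$ denotes the derivative with respect to $s$, and $\nabla^2_g$, $\Delta_g=\mathrm{tr}_g\nabla^2_g$ and $\mathrm{Ric}$ are the Hessian, the Laplacian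 and the Ricci curvature. -/

import Mathlib

open scoped Manifold ContDiff Topology
open Bundle

noncomputable section

namespace WarpedCritical

section Coordinates

variable {E : Type*} [NormedAddCommGroup E] [NormedSpace ℝ E]

/-- The Christoffel symbols of the first kind of a field `G` of bilinear forms on the vector space
`E` at the point `y`, as the linear form
`z ↦ ½ (D_u G (v, z) + D_v G (u, z) - D_z G (u, v))`. -/
def christoffelFirst (G : E → E →L[ℝ] E →L[ℝ] ℝ) (y u v : E) : E →L[ℝ] ℝ :=
  (1 / 2 : ℝ) • (fderiv ℝ (fun x => G x v) y u + fderiv ℝ (fun x => G x u) y v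
    - fderiv ℝ (fun x => G x u v) y)

/-- The Christoffel symbols of the second kind of `G` at `y`: `christoffel G y u v` is the vector
`Γ(u, v)` with `G y (Γ(u, v)) = christoffelFirst G y u v`. -/
def christoffel (G : E → E →L[ℝ] E →L[ℝ] ℝ) (y u v : E) : E :=
  (G y).inverse (christoffelFirst G y u v)

/-- The Riemann curvature `R(u, v) w` of `G` at `y`, in the sign convention
`R(u, v) w = ∇_u ∇_v w - ∇_v ∇_u w - ∇_{[u, v]} w`. -/
def curvature (G : E → E →L[ℝ] E →L[ℝ] ℝ) (y u v w : E) : E :=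
  fderiv ℝ (fun x => christoffel G x v w) y u - fderiv ℝ (fun x => christoffel G x u w) y v
    + christoffel G y u (christoffel G y v w) - christoffel G y v (christoffel G y u w)

/-- The Ricci curvature of `G` at `y`: `Ric(v, w)` is the trace of the map `u ↦ R(u, v) w`. -/
def coordRicci [FiniteDimensional ℝ E] (G : E → E →L[ℝ] E →L[ℝ] ℝ) (y v w : E) : ℝ :=
  ∑ i, (Module.finBasis ℝ E).coord i (curvature G y (Module.finBasis ℝ E i) v w)

/-- The Hessian of `f` with respect to `G` at `y`:
`∇²f(u, v) = D²f(u, v) - Df(Γ(u, v))`. -/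
def coordHessian (G : E → E →L[ℝ] E →L[ℝ] ℝ) (f : E → ℝ) (y u v : E) : ℝ :=
  fderiv ℝ (fun x => fderiv ℝ f x v) y u - fderiv ℝ f y (christoffel G y u v)

/-- The trace of the bilinear form `B` with respect to the inner product `g`, i.e.
`∑ i j, g^{ij} B(e_i, e_j)` in a basis `e` of `E`: with `e^i` the dual basis,
`g.inverse e^i = ∑ j, g^{ij} e_j`. -/
def metricTrace [FiniteDimensional ℝ E] (g : E →L[ℝ] E →L[ℝ] ℝ) (B : E → E → ℝ) : ℝ :=
  ∑ i, B (Module.finBasis ℝ E i)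
    (g.inverse (LinearMap.toContinuousLinearMap ((Module.finBasis ℝ E).coord i)))

end Coordinates

section Pullback

variable {V W : Type*} [AddCommGroup V] [Module ℝ V] [TopologicalSpace V]
  [AddCommGroup W] [Module ℝ W] [TopologicalSpace W]

/-- The pull-back `(u, v) ↦ B (A u) (A v)` of a bilinear form `B` by a linear map `A`. -/
def pullbackForm (A : V →L[ℝ] W) (B : W →L[ℝ] W →L[ℝ] ℝ) : V →L[ℝ] V →L[ℝ] ℝ :=
  ContinuousLinearMap.precomp ℝ A ∘L (B ∘L A)

@[simp]
theorem pullbackForm_apply (A : V →L[ℝ] W) (B : W →L[ℝ] W →L[ℝ] ℝ) (u v : V) :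
    pullbackForm A B u v = B (A u) (A v) := rfl

end Pullback

section Manifold

variable {E : Type*} [NormedAddCommGroup E] [NormedSpace ℝ E]
  {H : Type*} [TopologicalSpace H] {I : ModelWithCorners ℝ E H}
  {M : Type*} [TopologicalSpace M] [ChartedSpace H M] [IsManifold I ∞ M]

/-- The expression of the Riemannian metric `g` in the preferred chart `φ` around `p`, i.e. the
pull-back of `g` by the inverse of `φ`. (Manifolds are meant without boundary.) -/
def chartMetric (g : ContMDiffRiemannianMetric I ∞ E (fun x : M => TangentSpace I x)) (p : M)
    (y : E) : E →L[ℝ] E →L[ℝ] ℝ :=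
  pullbackForm (V := E) (mfderiv 𝓘(ℝ, E) I (extChartAt I p).symm y)
    (g.inner ((extChartAt I p).symm y))

/-- The differential at `p` of the preferred chart around `p`. -/
def chartDiff (I : ModelWithCorners ℝ E H) (p : M) : TangentSpace I p →L[ℝ] E :=
  mfderiv I 𝓘(ℝ, E) (extChartAt I p) p

/-- The Ricci curvature of `g` at `p`, computed in the preferred chart around `p`. -/
def ricci [FiniteDimensional ℝ E]
    (g : ContMDiffRiemannianMetric I ∞ E (fun x : M => TangentSpace I x)) (p : M)
    (u v : TangentSpace I p) : ℝ :=
  coordRicci (chartMetric g p) (extChartAt I p p) (chartDiff I p u) (chartDiff I p v)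

/-- The scalar curvature of `g` at `p`: the `g`-trace of the Ricci curvature. -/
def scalarCurvature [FiniteDimensional ℝ E]
    (g : ContMDiffRiemannianMetric I ∞ E (fun x : M => TangentSpace I x)) (p : M) : ℝ :=
  metricTrace (chartMetric g p (extChartAt I p p))
    (coordRicci (chartMetric g p) (extChartAt I p p))

/-- The Hessian `∇²_g f` of the function `f` at `p`. -/
def hessian (g : ContMDiffRiemannianMetric I ∞ E (fun x : M => TangentSpace I x)) (f : M → ℝ)
    (p : M) (u v : TangentSpace I p) : ℝ :=
  coordHessian (chartMetric g p) (f ∘ (extChartAt I p).symm) (extChartAt I p p)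
    (chartDiff I p u) (chartDiff I p v)

/-- The Laplacian `Δ_g f` of the function `f` at `p`: the `g`-trace of the Hessian. -/
def laplacian [FiniteDimensional ℝ E]
    (g : ContMDiffRiemannianMetric I ∞ E (fun x : M => TangentSpace I x)) (f : M → ℝ) (p : M) : ℝ :=
  metricTrace (chartMetric g p (extChartAt I p p))
    (coordHessian (chartMetric g p) (f ∘ (extChartAt I p).symm) (extChartAt I p p))

/-- The equation `-(Δ_g f) g + ∇²_g f - f Ric(g) = g` on `M`. -/
def SatisfiesCriticalEquation [FiniteDimensional ℝ E]
    (g : ContMDiffRiemannianMetric I ∞ E (fun x : M => TangentSpace I x)) (f : M → ℝ) : Prop :=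
  ∀ (p : M) (u v : TangentSpace I p),
    -(laplacian g f p) * g.inner p u v + hessian g f p u v - f p * ricci g p u v = g.inner p u v

end Manifold

section PullbackSmooth

variable {E : Type*} [NormedAddCommGroup E] [NormedSpace ℝ E]
  {H : Type*} [TopologicalSpace H] {I : ModelWithCorners ℝ E H}
  {M : Type*} [TopologicalSpace M] [ChartedSpace H M]
  {E' : Type*} [NormedAddCommGroup E'] [NormedSpace ℝ E']
  {H' : Type*} [TopologicalSpace H'] {I' : ModelWithCorners ℝ E' H'}
  {M' : Type*} [TopologicalSpace M'] [ChartedSpace H' M'] [IsManifold I' ∞ M']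

theorem contMDiffAt_clm_aux {D D' : Type*} [NormedAddCommGroup D] [NormedSpace ℝ D]
    [NormedAddCommGroup D'] [NormedSpace ℝ D'] (c : (E →L[ℝ] E') →L[ℝ] D' →L[ℝ] D)
    {A : M → E →L[ℝ] E'} {B : M → E' →L[ℝ] D'} {x₀ : M}
    (hA : ContMDiffAt I 𝓘(ℝ, E →L[ℝ] E') ∞ A x₀) (hB : ContMDiffAt I 𝓘(ℝ, E' →L[ℝ] D') ∞ B x₀) :
    ContMDiffAt I 𝓘(ℝ, E →L[ℝ] D) ∞ (fun x => c (A x) ∘L (B x ∘L A x)) x₀ :=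
  ContMDiffAt.clm_comp (c.contMDiff.contMDiffAt.comp x₀ hA) (ContMDiffAt.clm_comp hB hA)

/-- The pull-back of a smooth field of bilinear forms by a smooth map is smooth. -/
theorem contMDiff_pullbackForm [IsManifold I ∞ M] {f : M → M'} (hf : ContMDiff I I' ∞ f)
    {B : ∀ x : M', TangentSpace I' x →L[ℝ] TangentSpace I' x →L[ℝ] ℝ}
    (hB : ContMDiff I' (I'.prod 𝓘(ℝ, E' →L[ℝ] E' →L[ℝ] ℝ)) ∞
      (fun x => TotalSpace.mk' (E' →L[ℝ] E' →L[ℝ] ℝ)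
        (E := fun x : M' => TangentSpace I' x →L[ℝ] TangentSpace I' x →L[ℝ] ℝ) x (B x))) :
    ContMDiff I (I.prod 𝓘(ℝ, E →L[ℝ] E →L[ℝ] ℝ)) ∞
      (fun x => TotalSpace.mk' (E →L[ℝ] E →L[ℝ] ℝ)
        (E := fun x : M => TangentSpace I x →L[ℝ] TangentSpace I x →L[ℝ] ℝ) x
        (pullbackForm (mfderiv I I' f x) (B (f x)))) := by
  intro x₀
  rw [contMDiffAt_hom_bundle]
  refine ⟨contMDiffAt_id, ?_⟩
  have h1 := (contMDiffAt_hom_bundle _).1 (hB (f x₀))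
  have h2 := h1.2.comp x₀ (hf x₀)
  have h3 : ContMDiffAt I 𝓘(ℝ, E →L[ℝ] E') ∞ _ x₀ :=
    ContMDiffAt.mfderiv_const (m := ∞) (hf x₀) (by simp)
  have h4 : ContMDiffAt I 𝓘(ℝ, E →L[ℝ] E →L[ℝ] ℝ) ∞ (fun x => pullbackForm
     (inTangentCoordinates I I' id f (mfderiv I I' f) x₀ x)
     (ContinuousLinearMap.inCoordinates E' (fun x : M' => TangentSpace I' x) (E' →L[ℝ] ℝ)
       (fun x : M' => TangentSpace I' x →L[ℝ] ℝ) (f x₀) (f x) (f x₀) (f x) (B (f x)))) x₀ :=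
    contMDiffAt_clm_aux (ContinuousLinearMap.compL ℝ E E' ℝ).flip h3 h2
  refine h4.congr_of_eventuallyEq ?_
  have e1 : ∀ᶠ x in 𝓝 x₀, x ∈ (trivializationAt E (TangentSpace I) x₀).baseSet :=
    (trivializationAt E (TangentSpace I) x₀).open_baseSet.mem_nhds
      (FiberBundle.mem_baseSet_trivializationAt' x₀)
  have e2 : ∀ᶠ x in 𝓝 x₀, f x ∈ (trivializationAt E' (TangentSpace I') (f x₀)).baseSet :=
    (hf x₀).continuousAt.eventually ((trivializationAt E' (TangentSpace I') (f x₀)).open_baseSet.mem_nhds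
      (FiberBundle.mem_baseSet_trivializationAt' (f x₀)))
  filter_upwards [e1, e2] with x hx hy
  refine ContinuousLinearMap.ext fun u => ContinuousLinearMap.ext fun v => ?_
  have hA : ∀ w : E, (trivializationAt E' (TangentSpace I') (f x₀)).symm (f x)
      (inTangentCoordinates I I' id f (mfderiv I I' f) x₀ x w) =
      mfderiv I I' f x ((trivializationAt E (TangentSpace I) x₀).symm x w) := by
    intro w
    change (trivializationAt E' (TangentSpace I') (f x₀)).symm (f x)
      (ContinuousLinearMap.inCoordinates E (TangentSpace I) E' (TangentSpace I') x₀ x (f x₀) (f x)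
        (mfderiv I I' f x) w) = _
    rw [ContinuousLinearMap.inCoordinates_eq hx hy]
    exact (Trivialization.symm_apply_apply_mk _ hy _)
  rw [pullbackForm_apply]
  rw [inCoordinates_apply_eq₂ hx hx (by simp), inCoordinates_apply_eq₂ hy hy (by simp)]
  rw [hA, hA]
  simp

end PullbackSmooth

section Warped

variable {E : Type*} [NormedAddCommGroup E] [NormedSpace ℝ E]
  {N : Type*} [TopologicalSpace N] [ChartedSpace E N]

/-- The differential of the projection `J × N → J ⊆ ℝ`, i.e. the one-form `ds`. -/
def dS (J : TopologicalSpace.Opens ℝ) (p : J × N) :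
    TangentSpace (𝓘(ℝ, ℝ).prod 𝓘(ℝ, E)) p →L[ℝ] ℝ :=
  mfderiv (𝓘(ℝ, ℝ).prod 𝓘(ℝ, E)) 𝓘(ℝ, ℝ) (fun q : J × N => (q.1 : ℝ)) p

/-- The differential of the projection `J × N → N`. -/
def dN (J : TopologicalSpace.Opens ℝ) (p : J × N) :
    TangentSpace (𝓘(ℝ, ℝ).prod 𝓘(ℝ, E)) p →L[ℝ] TangentSpace 𝓘(ℝ, E) p.2 :=
  mfderiv (𝓘(ℝ, ℝ).prod 𝓘(ℝ, E)) 𝓘(ℝ, E) (Prod.snd : J × N → N) p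

theorem dS_apply (J : TopologicalSpace.Opens ℝ) (p : J × N)
    (u : TangentSpace (𝓘(ℝ, ℝ).prod 𝓘(ℝ, E)) p) : dS J p u = u.1 := by
  have h : HasMFDerivAt (𝓘(ℝ, ℝ).prod 𝓘(ℝ, E)) 𝓘(ℝ, ℝ) (fun q : J × N => (q.1 : ℝ)) p
      (ContinuousLinearMap.fst ℝ ℝ E) := by
    have h1 : HasMFDerivAt 𝓘(ℝ, ℝ) 𝓘(ℝ, ℝ) (Subtype.val : J → ℝ) p.1
        (ContinuousLinearMap.id ℝ ℝ) := by
      refine ⟨continuousAt_subtype_val, ?_⟩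
      refine ((hasFDerivAt_id (extChartAt 𝓘(ℝ, ℝ) p.1 p.1)).congr_of_eventuallyEq
        ?_).hasFDerivWithinAt
      filter_upwards [extChartAt_target_mem_nhds (I := 𝓘(ℝ, ℝ)) p.1] with y hy
      exact (extChartAt 𝓘(ℝ, ℝ) p.1).right_inv hy
    exact h1.comp p (hasMFDerivAt_fst p)
  rw [dS, h.mfderiv]; rfl

theorem dN_apply (J : TopologicalSpace.Opens ℝ) (p : J × N)
    (u : TangentSpace (𝓘(ℝ, ℝ).prod 𝓘(ℝ, E)) p) : dN J p u = u.2 := by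
  simp only [dN, mfderiv_snd]; rfl

variable [IsManifold 𝓘(ℝ, E) ∞ N]

/-- The bilinear form `ds² + r² h` on `T_p (J × N)`. -/
def warpedInner (J : TopologicalSpace.Opens ℝ) (r : ℝ → ℝ)
    (h : ContMDiffRiemannianMetric 𝓘(ℝ, E) ∞ E (fun x : N => TangentSpace 𝓘(ℝ, E) x))
    (p : J × N) : TangentSpace (𝓘(ℝ, ℝ).prod 𝓘(ℝ, E)) p →L[ℝ]
      TangentSpace (𝓘(ℝ, ℝ).prod 𝓘(ℝ, E)) p →L[ℝ] ℝ :=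
  pullbackForm (dS J p) ((riemannianMetricVectorSpace ℝ).inner p.1) +
    (r p.1) ^ 2 • pullbackForm (dN J p) (h.inner p.2)

theorem warpedInner_apply (J : TopologicalSpace.Opens ℝ) (r : ℝ → ℝ)
    (h : ContMDiffRiemannianMetric 𝓘(ℝ, E) ∞ E (fun x : N => TangentSpace 𝓘(ℝ, E) x))
    (p : J × N) (u v : TangentSpace (𝓘(ℝ, ℝ).prod 𝓘(ℝ, E)) p) :
    warpedInner J r h p u v =
      dS J p u * dS J p v + (r p.1) ^ 2 * h.inner p.2 (dN J p u) (dN J p v) := by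
  rw [mul_comm]; rfl

theorem isVonNBounded_of_pos {F : Type*} [NormedAddCommGroup F] [NormedSpace ℝ F]
    [FiniteDimensional ℝ F] (B : F →L[ℝ] F →L[ℝ] ℝ) (hB : ∀ v, v ≠ 0 → 0 < B v v) :
    Bornology.IsVonNBounded ℝ {v : F | B v v < 1} := by
  rw [NormedSpace.isVonNBounded_iff]
  have hcont : Continuous fun v : F => B v v := by fun_prop
  rcases (Metric.sphere (0 : F) 1).eq_empty_or_nonempty with he | hne
  · refine (Bornology.isBounded_singleton (x := (0 : F))).subset fun v _ => ?_
    by_contra hv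
    have hv' : ‖v‖ ≠ 0 := norm_ne_zero_iff.2 hv
    have : ‖v‖⁻¹ • v ∈ Metric.sphere (0 : F) 1 := by simp [norm_smul, hv']
    rw [he] at this
    exact this
  · have : ProperSpace F := FiniteDimensional.proper_real F
    obtain ⟨w, hw, hmin⟩ := (isCompact_sphere (0 : F) 1).exists_isMinOn hne hcont.continuousOn
    have hw0 : w ≠ 0 := by rintro rfl; simp at hw
    have hc := hB w hw0
    refine (Metric.isBounded_closedBall (x := (0 : F)) (r := 1 + (B w w)⁻¹)).subset fun v hv => ?_
    rw [mem_closedBall_zero_iff]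
    by_cases hv0 : v = 0
    · subst hv0; rw [norm_zero]; positivity
    have hn : 0 < ‖v‖ := norm_pos_iff.2 hv0
    have hm : B w w ≤ B (‖v‖⁻¹ • v) (‖v‖⁻¹ • v) :=
      hmin (by simp [norm_smul, hn.ne'] : ‖v‖⁻¹ • v ∈ Metric.sphere (0 : F) 1)
    have hv1 : B v v < 1 := hv
    simp only [map_smul, smul_apply, smul_eq_mul] at hm
    have h2 : B w w * ‖v‖ ^ 2 ≤ B v v := by
      calc B w w * ‖v‖ ^ 2 ≤ (‖v‖⁻¹ * (‖v‖⁻¹ * B v v)) * ‖v‖ ^ 2 := by gcongr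
        _ = B v v := by field_simp
    have h3 : ‖v‖ ^ 2 ≤ (B w w)⁻¹ := by
      rw [← one_div, le_div_iff₀ hc]; linarith
    nlinarith [sq_nonneg (‖v‖ - 1)]

theorem warpedInner_pos (J : TopologicalSpace.Opens ℝ) (r : ℝ → ℝ) (hpos : ∀ s ∈ J, 0 < r s)
    (h : ContMDiffRiemannianMetric 𝓘(ℝ, E) ∞ E (fun x : N => TangentSpace 𝓘(ℝ, E) x))
    (p : J × N) (u : TangentSpace (𝓘(ℝ, ℝ).prod 𝓘(ℝ, E)) p) (hu : u ≠ 0) :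
    0 < warpedInner J r h p u u := by
  rw [warpedInner_apply]
  have hr : 0 < r p.1 ^ 2 := pow_pos (hpos _ p.1.2) 2
  by_cases h2 : dN J p u = 0
  · have h1 : dS J p u ≠ 0 := fun h1 =>
      hu (Prod.ext ((dS_apply J p u).symm.trans h1) ((dN_apply J p u).symm.trans h2))
    rw [h2, map_zero, mul_zero, add_zero]
    exact mul_self_pos.2 h1
  · exact add_pos_of_nonneg_of_pos (mul_self_nonneg _) (mul_pos hr (h.pos p.2 _ h2))

set_option synthInstance.maxHeartbeats 400000 in
/-- The warped product metric `ds² + r² h` on `J × N`, for an open set `J` of `ℝ` and a smooth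
positive function `r` on `J`. -/
def warpedMetric [FiniteDimensional ℝ E] (J : TopologicalSpace.Opens ℝ) (r : ℝ → ℝ) (hr : ContDiffOn ℝ ∞ r J)
    (hpos : ∀ s ∈ J, 0 < r s)
    (h : ContMDiffRiemannianMetric 𝓘(ℝ, E) ∞ E (fun x : N => TangentSpace 𝓘(ℝ, E) x)) :
    ContMDiffRiemannianMetric (𝓘(ℝ, ℝ).prod 𝓘(ℝ, E)) ∞ (ℝ × E)
      (fun p : J × N => TangentSpace (𝓘(ℝ, ℝ).prod 𝓘(ℝ, E)) p) where
  inner := warpedInner J r h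
  symm p u v := by
    rw [warpedInner_apply, warpedInner_apply, h.symm, mul_comm (dS J p u)]
  pos p u hu := warpedInner_pos J r hpos h p u hu
  isVonNBounded p := isVonNBounded_of_pos (F := ℝ × E) (warpedInner J r h p)
    (fun u hu => warpedInner_pos J r hpos h p u hu)
  contMDiff := by
    have h1 : ContMDiff (𝓘(ℝ, ℝ).prod 𝓘(ℝ, E)) 𝓘(ℝ, ℝ) ∞ (fun q : J × N => (q.1 : ℝ)) :=
      contMDiff_subtype_val.comp contMDiff_fst
    have h2 : ContMDiff (𝓘(ℝ, ℝ).prod 𝓘(ℝ, E)) 𝓘(ℝ, ℝ) ∞ (fun q : J × N => (r q.1) ^ 2) := by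
      intro q
      exact (((hr.contDiffAt (J.isOpen.mem_nhds q.1.2)).contMDiffAt).comp q (h1 q)).pow 2
    exact ContMDiff.add_section
      (contMDiff_pullbackForm h1 ((riemannianMetricVectorSpace ℝ).contMDiff.of_le le_top))
      (ContMDiff.smul_section h2 (contMDiff_pullbackForm contMDiff_snd h.contMDiff))

end Warped

end WarpedCritical

end

/-! Write `l = n - 2`, so that `N` has dimension `l + 1`, and `k = R / (n (n - 1))`. For `g = ds² +
r² h` the Hessian of `λ(s)` is `λ'' ds² + r r' λ' h`, and the Ricci tensor is `-(l + 1) (r''/r) ds²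
+ Ric(h) - (r r'' + l r'²) h`. Hence the tensor equation splits into a `ds²` component and an `N`
component.

The `ds²` component is exactly the first-order relation (ii): `λ''` cancels. It forbids `λ ≡ 0`,
since `r > 0`. At any `s` with `λ(s) ≠ 0` the `N` component then expresses `Ric(h)` as a multiple of
`h` whose factor depends on `s` alone, so `h` is Einstein. The scalar curvature condition becomes `2
r r'' + l r'² + (l + 2) k r² = l κ₀`; differentiating it shows that `(r'' + k r) r^(l+1)` is a
constant `a`, and substituting back gives the second equation of (i) (`exists_eq_of_scalar_eq`).

Conversely, eliminating `a` from (i) recovers the scalar curvature equation. The `N` component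
contains `λ''`, while (ii) is of first order, so (ii) is differentiated; with `r'''` taken from (i)
this gives `r' D = 0`, where `D = 0` is the missing second-order equation for `λ`. The zeros of `r'`
are isolated by (ii), so `D = 0` everywhere by continuity (`deriv_deriv_eq_of_first_order`).

Since all curvatures are defined through charts, much of the work is to derive the warped product
formulas from Christoffel symbols (`coordRicci_warpedForm`, `coordHessian_warpedForm`) and to
identify the chart expression of the metric (`chartMetric_warpedMetric`). -/

noncomputable section

namespace WarpedCritical

/-! ### Christoffel symbols, curvature and traces on a vector space. -/

section CoordinateLemmas

set_option synthInstance.maxHeartbeats 400000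

variable {E : Type*} [NormedAddCommGroup E] [NormedSpace ℝ E]
  {G G' : E → E →L[ℝ] E →L[ℝ] ℝ} {y : E}

theorem christoffelFirst_apply (hG : DifferentiableAt ℝ G y) (u v w : E) :
    christoffelFirst G y u v w =
      1 / 2 * (fderiv ℝ G y u v w + fderiv ℝ G y v u w - fderiv ℝ G y w u v) := by
  have h1 : ∀ v : E, fderiv ℝ (fun x => G x v) y = (fderiv ℝ G y).flip v := fun v => by
    simpa using (hG.hasFDerivAt.clm_apply (hasFDerivAt_const v y)).fderiv
  have h2 : fderiv ℝ (fun x => G x u v) y = ((fderiv ℝ G y).flip u).flip v := by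
    have := ((hG.hasFDerivAt.clm_apply (hasFDerivAt_const u y)).clm_apply
      (hasFDerivAt_const v y)).fderiv
    simpa using this
  simp [christoffelFirst, h1, h2]

theorem christoffelFirst_comm (hs : ∀ x u v, G x u v = G x v u) (u v : E) :
    christoffelFirst G y u v = christoffelFirst G y v u := by
  have : (fun x => G x u v) = fun x => G x v u := funext fun x => hs x u v
  rw [christoffelFirst, christoffelFirst, this, add_comm]

theorem christoffel_comm (hs : ∀ x u v, G x u v = G x v u) (u v : E) :
    christoffel G y u v = christoffel G y v u := by
  rw [christoffel, christoffel, christoffelFirst_comm hs]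

theorem christoffel_add_left (hG : DifferentiableAt ℝ G y) (u u' v : E) :
    christoffel G y (u + u') v = christoffel G y u v + christoffel G y u' v := by
  have : christoffelFirst G y (u + u') v = christoffelFirst G y u v + christoffelFirst G y u' v := by
    ext w
    simp only [add_apply, christoffelFirst_apply hG, map_add]
    ring
  rw [christoffel, this, map_add]; rfl

theorem christoffel_smul_left (hG : DifferentiableAt ℝ G y) (c : ℝ) (u v : E) :
    christoffel G y (c • u) v = c • christoffel G y u v := by
  have : christoffelFirst G y (c • u) v = c • christoffelFirst G y u v := by
    ext w
    simp only [smul_apply, christoffelFirst_apply hG, map_smul, smul_eq_mul]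
    ring
  rw [christoffel, this, map_smul]; rfl

theorem christoffel_add_right (hG : DifferentiableAt ℝ G y) (hs : ∀ x u v, G x u v = G x v u)
    (u v v' : E) :
    christoffel G y u (v + v') = christoffel G y u v + christoffel G y u v' := by
  simp only [christoffel_comm hs u, christoffel_add_left hG]

theorem christoffel_smul_right (hG : DifferentiableAt ℝ G y) (hs : ∀ x u v, G x u v = G x v u)
    (c : ℝ) (u v : E) :
    christoffel G y u (c • v) = c • christoffel G y u v := by
  simp only [christoffel_comm hs u, christoffel_smul_left hG]

theorem apply_christoffel (hG : (G y).IsInvertible) (u v w : E) :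
    G y (christoffel G y u v) w = christoffelFirst G y u v w := by
  rw [christoffel, hG.self_apply_inverse]

theorem differentiableAt_christoffel [CompleteSpace E] (hG : ContDiffAt ℝ ∞ G y)
    (hi : (G y).IsInvertible) (u v : E) : DifferentiableAt ℝ (fun x => christoffel G x u v) y := by
  have hinv : DifferentiableAt ℝ (fun x => (G x).inverse) y :=
    ((hi.contDiffAt_map_inverse (n := ∞)).comp y hG).differentiableAt (by simp)
  have hd : ∀ v : E, DifferentiableAt ℝ (fderiv ℝ (fun x => G x v)) y := fun v =>
    ((hG.clm_apply contDiffAt_const).fderiv_right (m := 1) (by rw [one_add_one_eq_two]; exact WithTop.coe_le_coe.2 le_top)).differentiableAt (by simp)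
  have hd2 : DifferentiableAt ℝ (fderiv ℝ (fun x => G x u v)) y :=
    (((hG.clm_apply contDiffAt_const).clm_apply contDiffAt_const).fderiv_right (m := 1)
      (by rw [one_add_one_eq_two]; exact WithTop.coe_le_coe.2 le_top)).differentiableAt (by simp)
  exact hinv.clm_apply (((((hd v).clm_apply (differentiableAt_const u)).add
    ((hd u).clm_apply (differentiableAt_const v))).sub hd2).const_smul (1 / 2 : ℝ))

theorem eventually_differentiableAt {F : Type*} [NormedAddCommGroup F] [NormedSpace ℝ F]
    {f : E → F} (hf : ContDiffAt ℝ ∞ f y) : ∀ᶠ x in 𝓝 y, DifferentiableAt ℝ f x := by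
  filter_upwards [(hf.of_le (m := 1) (by exact_mod_cast le_top)).eventually (by simp)] with x hx
  exact hx.differentiableAt (by simp)

theorem contDiffAt_deriv {f : ℝ → ℝ} {t : ℝ} (hf : ContDiffAt ℝ ∞ f t) :
    ContDiffAt ℝ ∞ (deriv f) t := by
  have h := (hf.fderiv_right (m := ∞) (by simp)).clm_apply (contDiffAt_const (c := (1 : ℝ)))
  simpa using h

theorem eventually_isInvertible [CompleteSpace E] (hG : ContinuousAt G y)
    (hi : (G y).IsInvertible) : ∀ᶠ x in 𝓝 y, (G x).IsInvertible := by
  obtain ⟨e, he⟩ := hi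
  have := ContinuousLinearEquiv.nhds e
  rw [he] at this
  filter_upwards [hG.eventually this] with x hx
  exact hx

/-- Linearity in the first slot is what makes the Ricci curvature a trace. The Christoffel symbols
are differentiated here, so their additivity is needed in a neighbourhood of `y`. -/
theorem curvature_add [CompleteSpace E] (hG : ContDiffAt ℝ ∞ G y) (hi : (G y).IsInvertible)
    (hs : ∀ x u v, G x u v = G x v u) (u u' v w : E) :
    curvature G y (u + u') v w = curvature G y u v w + curvature G y u' v w := by
  have hd : DifferentiableAt ℝ G y := hG.differentiableAt (by simp)
  have h1 : fderiv ℝ (fun x => christoffel G x (u + u') w) y =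
      fderiv ℝ (fun x => christoffel G x u w) y + fderiv ℝ (fun x => christoffel G x u' w) y := by
    rw [← fderiv_fun_add (differentiableAt_christoffel hG hi u w)
      (differentiableAt_christoffel hG hi u' w)]
    refine Filter.EventuallyEq.fderiv_eq ?_
    filter_upwards [eventually_differentiableAt hG] with x hx
    exact christoffel_add_left hx u u' w
  simp only [curvature, h1, christoffel_add_left hd, christoffel_add_right hd hs, map_add, add_apply]
  abel

theorem curvature_smul [CompleteSpace E] (hG : ContDiffAt ℝ ∞ G y) (hi : (G y).IsInvertible)
    (hs : ∀ x u v, G x u v = G x v u) (c : ℝ) (u v w : E) :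
    curvature G y (c • u) v w = c • curvature G y u v w := by
  have hd : DifferentiableAt ℝ G y := hG.differentiableAt (by simp)
  have h1 : fderiv ℝ (fun x => christoffel G x (c • u) w) y =
      c • fderiv ℝ (fun x => christoffel G x u w) y := by
    rw [← fderiv_fun_const_smul (differentiableAt_christoffel hG hi u w)]
    refine Filter.EventuallyEq.fderiv_eq ?_
    filter_upwards [eventually_differentiableAt hG] with x hx
    exact christoffel_smul_left hx c u w
  simp only [curvature, h1, christoffel_smul_left hd, christoffel_smul_right hd hs, map_smul,
    smul_apply, smul_add, smul_sub]

/-- This and the congruence lemmas below are needed because the chart expression of a warped product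
has its explicit form only near the base point. -/
theorem christoffel_congr (h : G =ᶠ[𝓝 y] G') (u v : E) :
    christoffel G y u v = christoffel G' y u v := by
  have h1 : ∀ v : E, (fun x => G x v) =ᶠ[𝓝 y] fun x => G' x v := fun v =>
    h.mono fun x hx => by simp only [hx]
  have h2 : (fun x => G x u v) =ᶠ[𝓝 y] fun x => G' x u v := h.mono fun x hx => by simp only [hx]
  rw [christoffel, christoffel, christoffelFirst, christoffelFirst, (h1 u).fderiv_eq,
    (h1 v).fderiv_eq, h2.fderiv_eq, h.eq_of_nhds]

theorem curvature_congr (h : G =ᶠ[𝓝 y] G') (u v w : E) :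
    curvature G y u v w = curvature G' y u v w := by
  have h1 : ∀ u v : E, (fun x => christoffel G x u v) =ᶠ[𝓝 y] fun x => christoffel G' x u v :=
    fun u v => (eventually_eventually_nhds.2 h).mono fun x hx => christoffel_congr hx u v
  simp only [curvature, (h1 _ _).fderiv_eq, christoffel_congr h]

theorem coordRicci_congr [FiniteDimensional ℝ E] (h : G =ᶠ[𝓝 y] G') :
    coordRicci G y = coordRicci G' y := by
  ext v w
  simp only [coordRicci, curvature_congr h]

/-- The linear map `u ↦ R(u, v) w`, whose trace is the Ricci curvature. -/
def curvatureMap [CompleteSpace E] (hG : ContDiffAt ℝ ∞ G y) (hi : (G y).IsInvertible)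
    (hs : ∀ x u v, G x u v = G x v u) (v w : E) : E →ₗ[ℝ] E where
  toFun u := curvature G y u v w
  map_add' u u' := curvature_add hG hi hs u u' v w
  map_smul' c u := curvature_smul hG hi hs c u v w

/-- Frees the Ricci curvature from the basis in its definition, so that on `ℝ × E` a basis adapted
to the product can be used. -/
theorem coordRicci_eq_trace [FiniteDimensional ℝ E] [CompleteSpace E] (hG : ContDiffAt ℝ ∞ G y)
    (hi : (G y).IsInvertible) (hs : ∀ x u v, G x u v = G x v u) (v w : E) :
    coordRicci G y v w = LinearMap.trace ℝ E (curvatureMap hG hi hs v w) := by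
  rw [LinearMap.trace_eq_matrix_trace ℝ (Module.finBasis ℝ E), Matrix.trace, coordRicci]
  refine Finset.sum_congr rfl fun i _ => ?_
  simp [LinearMap.toMatrix_apply, curvatureMap]

theorem coordHessian_congr {f f' : E → ℝ} (h : G =ᶠ[𝓝 y] G') (hf : f =ᶠ[𝓝 y] f') :
    coordHessian G f y = coordHessian G' f' y := by
  ext u v
  have : (fun x => fderiv ℝ f x v) =ᶠ[𝓝 y] fun x => fderiv ℝ f' x v :=
    (eventually_eventually_nhds.2 hf).mono fun x hx => by
      show fderiv ℝ f x v = fderiv ℝ f' x v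
      rw [Filter.EventuallyEq.fderiv_eq hx]
  rw [coordHessian, coordHessian, this.fderiv_eq, hf.fderiv_eq, christoffel_congr h]

theorem isInvertible_of_nondegenerate [FiniteDimensional ℝ E] {B : E →L[ℝ] E →L[ℝ] ℝ}
    (hB : ∀ v, (∀ w, B v w = 0) → v = 0) : B.IsInvertible := by
  have hinj : Function.Injective (B : E →ₗ[ℝ] E →L[ℝ] ℝ) := by
    rw [← LinearMap.ker_eq_bot, LinearMap.ker_eq_bot']
    intro v hv
    have h0 : B v = 0 := hv
    exact hB v fun w => by rw [h0]; rfl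
  have hfin : Module.finrank ℝ E = Module.finrank ℝ (E →L[ℝ] ℝ) := by
    rw [← (LinearMap.toContinuousLinearMap (𝕜 := ℝ) (E := E) (F' := ℝ)).finrank_eq]
    exact (Subspace.dual_finrank_eq (K := ℝ) (V := E)).symm
  refine ⟨(LinearEquiv.ofInjectiveOfFinrankEq _ hinj hfin).toContinuousLinearEquiv, ?_⟩
  ext v w
  rfl

/-- By symmetry, `g(S e_i, g⁻¹ e^i) = g(g⁻¹ e^i, S e_i) = e^i(S e_i)`, a diagonal entry of `S`. -/
theorem metricTrace_eq_trace [FiniteDimensional ℝ E] {g : E →L[ℝ] E →L[ℝ] ℝ}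
    (hg : g.IsInvertible) (hs : ∀ u v, g u v = g v u) {B : E → E → ℝ} (S : E →ₗ[ℝ] E)
    (hB : ∀ u v, B u v = g (S u) v) : metricTrace g B = LinearMap.trace ℝ E S := by
  rw [LinearMap.trace_eq_matrix_trace ℝ (Module.finBasis ℝ E), Matrix.trace, metricTrace]
  refine Finset.sum_congr rfl fun i _ => ?_
  rw [hB, hs, hg.self_apply_inverse]
  simp [LinearMap.toMatrix_apply]

theorem trace_prod_eq {F : Type*} [NormedAddCommGroup F] [NormedSpace ℝ F]
    [FiniteDimensional ℝ F] (T : ℝ × F →ₗ[ℝ] ℝ × F) :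
    LinearMap.trace ℝ (ℝ × F) T =
      (T (1, 0)).1 + LinearMap.trace ℝ F (LinearMap.snd ℝ ℝ F ∘ₗ T ∘ₗ LinearMap.inr ℝ ℝ F) := by
  classical
  rw [LinearMap.trace_eq_matrix_trace ℝ
      ((Module.Basis.singleton Unit ℝ).prod (Module.finBasis ℝ F)),
    LinearMap.trace_eq_matrix_trace ℝ (Module.finBasis ℝ F), Matrix.trace, Matrix.trace]
  simp [LinearMap.toMatrix_apply]

end CoordinateLemmas

/-! ### Curvature and Hessian of `dt² + r² H` on `ℝ × E`. -/

section WarpedCoordinates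

set_option synthInstance.maxHeartbeats 400000

section Composition

variable {E F : Type*} [NormedAddCommGroup E] [NormedSpace ℝ E] [NormedAddCommGroup F]
  [NormedSpace ℝ F] {f : E → F} {y : ℝ × E}

theorem hasFDerivAt_comp_snd {f' : E →L[ℝ] F} (hf : HasFDerivAt f f' y.2) :
    HasFDerivAt (fun x : ℝ × E => f x.2) (f' ∘L ContinuousLinearMap.snd ℝ ℝ E) y :=
  HasFDerivAt.comp (g := f) (f := Prod.snd) y hf hasFDerivAt_snd

theorem contDiffAt_comp_fst_smul {k : WithTop ℕ∞} {r : ℝ → ℝ} {f : ℝ × E → F}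
    (hr : ContDiffAt ℝ k r y.1) (hf : ContDiffAt ℝ k f y) :
    ContDiffAt ℝ k (fun x : ℝ × E => r x.1 • f x) y :=
  (ContDiffAt.comp (g := r) y hr contDiffAt_fst).smul hf

theorem differentiableAt_comp_fst_smul {r : ℝ → ℝ} {f : ℝ × E → F}
    (hr : DifferentiableAt ℝ r y.1) (hf : DifferentiableAt ℝ f y) :
    DifferentiableAt ℝ (fun x : ℝ × E => r x.1 • f x) y :=
  (DifferentiableAt.comp (g := r) y hr differentiableAt_fst).smul hf

end Composition

variable {E : Type*} [NormedAddCommGroup E] [NormedSpace ℝ E]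
  {r : ℝ → ℝ} {H : E → E →L[ℝ] E →L[ℝ] ℝ} {y : ℝ × E}

/-- The coordinate expression `dt² + r(t)² H` of a warped product metric on `ℝ × E`. -/
def warpedForm (r : ℝ → ℝ) (H : E → E →L[ℝ] E →L[ℝ] ℝ) (y : ℝ × E) :
    (ℝ × E) →L[ℝ] (ℝ × E) →L[ℝ] ℝ :=
  pullbackForm (ContinuousLinearMap.fst ℝ ℝ E) (ContinuousLinearMap.mul ℝ ℝ) +
    (r y.1) ^ 2 • pullbackForm (ContinuousLinearMap.snd ℝ ℝ E) (H y.2)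

theorem warpedForm_apply (y U V : ℝ × E) :
    warpedForm r H y U V = U.1 * V.1 + r y.1 ^ 2 * H y.2 U.2 V.2 := rfl

theorem warpedForm_comm (hs : ∀ x u v, H x u v = H x v u) (y U V : ℝ × E) :
    warpedForm r H y U V = warpedForm r H y V U := by
  rw [warpedForm_apply, warpedForm_apply, hs, mul_comm U.1]

theorem contDiffAt_warpedForm {k : WithTop ℕ∞} (hr : ContDiffAt ℝ k r y.1)
    (hH : ContDiffAt ℝ k H y.2) : ContDiffAt ℝ k (warpedForm r H) y := by
  have h1 : ContDiffAt ℝ k (fun x : ℝ × E => H x.2) y :=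
    ContDiffAt.comp (g := H) (f := (Prod.snd : ℝ × E → E)) y hH contDiffAt_snd
  have h3 : ContDiffAt ℝ k
      (fun x : ℝ × E => pullbackForm (ContinuousLinearMap.snd ℝ ℝ E) (H x.2)) y :=
    contDiffAt_const.clm_comp (h1.clm_comp contDiffAt_const)
  exact contDiffAt_const.add (contDiffAt_comp_fst_smul (r := fun t => r t ^ 2) (hr.pow 2) h3)

theorem differentiableAt_warpedForm (hr : DifferentiableAt ℝ r y.1)
    (hH : DifferentiableAt ℝ H y.2) : DifferentiableAt ℝ (warpedForm r H) y := by
  have h1 : DifferentiableAt ℝ (fun x : ℝ × E => H x.2) y :=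
    (hasFDerivAt_comp_snd (F := E →L[ℝ] E →L[ℝ] ℝ) (f := H) (y := y) hH.hasFDerivAt).differentiableAt
  have h3 : DifferentiableAt ℝ
      (fun x : ℝ × E => pullbackForm (ContinuousLinearMap.snd ℝ ℝ E) (H x.2)) y :=
    (differentiableAt_const _).clm_comp (h1.clm_comp (differentiableAt_const _))
  exact (differentiableAt_comp_fst_smul
    (F := (ℝ × E) →L[ℝ] (ℝ × E) →L[ℝ] ℝ) (r := fun t => r t ^ 2) (hr.pow 2) h3).const_add _

theorem fderiv_warpedForm (hr : DifferentiableAt ℝ r y.1)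
    (hH : DifferentiableAt ℝ H y.2) (U V W : ℝ × E) :
    fderiv ℝ (warpedForm r H) y U V W =
      2 * r y.1 * deriv r y.1 * U.1 * H y.2 V.2 W.2 +
        r y.1 ^ 2 * fderiv ℝ H y.2 U.2 V.2 W.2 := by
  have hG := differentiableAt_warpedForm hr hH
  have h1 := (hG.hasFDerivAt.clm_apply (hasFDerivAt_const V y)).clm_apply (hasFDerivAt_const W y)
  have h2 : HasFDerivAt (fun x : ℝ × E => H x.2) (fderiv ℝ H y.2 ∘L ContinuousLinearMap.snd ℝ ℝ E) y :=
    hasFDerivAt_comp_snd (F := E →L[ℝ] E →L[ℝ] ℝ) (f := H) (y := y) hH.hasFDerivAt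
  have h3 := (h2.clm_apply (hasFDerivAt_const V.2 y)).clm_apply (hasFDerivAt_const W.2 y)
  have h4 : HasFDerivAt (fun x : ℝ × E => r x.1)
      (deriv r y.1 • ContinuousLinearMap.fst ℝ ℝ E) y :=
    hr.hasDerivAt.comp_hasFDerivAt y hasFDerivAt_fst
  have h5 := ((h4.pow 2).mul h3).const_add (V.1 * W.1)
  have := congrArg (fun L : (ℝ × E) →L[ℝ] ℝ => L U) (h1.unique h5)
  simp at this
  rw [this]
  ring

theorem isInvertible_warpedForm [FiniteDimensional ℝ E] (hr : r y.1 ≠ 0)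
    (hH : (H y.2).IsInvertible) : (warpedForm r H y).IsInvertible := by
  refine isInvertible_of_nondegenerate fun U hU => Prod.ext ?_ ?_
  · simpa [warpedForm_apply] using hU (1, 0)
  · have h0 : H y.2 U.2 = 0 := by
      ext w
      simpa [warpedForm_apply, hr] using hU (0, w)
    rw [← hH.inverse_apply_self U.2, h0, map_zero]
    rfl

/-- The metric is invertible, so it suffices to lower the index on the right-hand side and compare
with the symbols of the first kind. -/
theorem christoffel_warpedForm [FiniteDimensional ℝ E] (hr : DifferentiableAt ℝ r y.1)
    (hr0 : r y.1 ≠ 0) (hH : DifferentiableAt ℝ H y.2) (hi : (H y.2).IsInvertible) (U V : ℝ × E) :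
    christoffel (warpedForm r H) y U V =
      (-(r y.1 * deriv r y.1) * H y.2 U.2 V.2,
        christoffel H y.2 U.2 V.2 + (deriv r y.1 / r y.1) • (U.1 • V.2 + V.1 • U.2)) := by
  rw [christoffel, (isInvertible_warpedForm hr0 hi).inverse_apply_eq]
  refine ContinuousLinearMap.ext fun W => ?_
  rw [christoffelFirst_apply (differentiableAt_warpedForm hr hH), warpedForm_apply]
  simp only [fderiv_warpedForm hr hH, map_add, map_smul, add_apply, smul_apply, smul_eq_mul,
    apply_christoffel hi, christoffelFirst_apply hH]
  field_simp
  ring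

theorem fderiv_christoffel_warpedForm [FiniteDimensional ℝ E] (hr : ContDiffAt ℝ ∞ r y.1)
    (hr0 : r y.1 ≠ 0) (hH : ContDiffAt ℝ ∞ H y.2) (hi : (H y.2).IsInvertible) (U V W : ℝ × E) :
    fderiv ℝ (fun x => christoffel (warpedForm r H) x V W) y U =
      (-(deriv r y.1 ^ 2 + r y.1 * deriv (deriv r) y.1) * U.1 * H y.2 V.2 W.2
          - r y.1 * deriv r y.1 * fderiv ℝ H y.2 U.2 V.2 W.2,
        fderiv ℝ (fun x => christoffel H x V.2 W.2) y.2 U.2 +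
          ((deriv (deriv r) y.1 * r y.1 - deriv r y.1 ^ 2) / r y.1 ^ 2 * U.1) •
            (V.1 • W.2 + W.1 • V.2)) := by
  have : CompleteSpace E := FiniteDimensional.complete ℝ E
  have hrd : DifferentiableAt ℝ r y.1 :=
    hr.differentiableAt (by simp)
  have hHd : DifferentiableAt ℝ H y.2 := hH.differentiableAt (by simp)
  have hr' : DifferentiableAt ℝ (deriv r) y.1 :=
    (contDiffAt_deriv hr).differentiableAt (by simp)
  -- Differentiability, `r ≠ 0` and invertibility of `H` persist near `y`, so the closed formula may
  -- be differentiated there.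
  have he : (fun x => christoffel (warpedForm r H) x V W) =ᶠ[𝓝 y] fun x =>
      (-(r x.1 * deriv r x.1) * H x.2 V.2 W.2,
        christoffel H x.2 V.2 W.2 + (deriv r x.1 / r x.1) • (V.1 • W.2 + W.1 • V.2)) := by
    filter_upwards [continuousAt_fst.eventually (eventually_differentiableAt hr),
      continuousAt_fst.eventually (hr.continuousAt.eventually_ne hr0),
      continuousAt_snd.eventually (eventually_differentiableAt hH),
      continuousAt_snd.eventually (eventually_isInvertible hH.continuousAt hi)] with x h1 h2 h3 h4
    exact christoffel_warpedForm h1 h2 h3 h4 V W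
  have h2 : HasFDerivAt (fun x : ℝ × E => H x.2) (fderiv ℝ H y.2 ∘L ContinuousLinearMap.snd ℝ ℝ E) y :=
    hasFDerivAt_comp_snd (F := E →L[ℝ] E →L[ℝ] ℝ) (f := H) (y := y) hHd.hasFDerivAt
  have h3 := (h2.clm_apply (hasFDerivAt_const V.2 y)).clm_apply (hasFDerivAt_const W.2 y)
  have h4 : HasFDerivAt (fun x : ℝ × E => -(r x.1 * deriv r x.1))
      (-(deriv r y.1 * deriv r y.1 + r y.1 * deriv (deriv r) y.1) • ContinuousLinearMap.fst ℝ ℝ E) y :=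
    HasDerivAt.comp_hasFDerivAt (h₂ := fun t => -(r t * deriv r t)) y
      ((hrd.hasDerivAt.mul hr'.hasDerivAt).neg) hasFDerivAt_fst
  have h5 : HasFDerivAt (fun x : ℝ × E => deriv r x.1 / r x.1)
      (((deriv (deriv r) y.1 * r y.1 - deriv r y.1 * deriv r y.1) / r y.1 ^ 2) •
        ContinuousLinearMap.fst ℝ ℝ E) y :=
    HasDerivAt.comp_hasFDerivAt (h₂ := fun t => deriv r t / r t) y
      (hr'.hasDerivAt.div hrd.hasDerivAt hr0) hasFDerivAt_fst
  have h6 : HasFDerivAt (fun x : ℝ × E => christoffel H x.2 V.2 W.2)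
      (fderiv ℝ (fun x => christoffel H x V.2 W.2) y.2 ∘L ContinuousLinearMap.snd ℝ ℝ E) y :=
    HasFDerivAt.comp (g := fun x => christoffel H x V.2 W.2) y
      (differentiableAt_christoffel hH hi V.2 W.2).hasFDerivAt hasFDerivAt_snd
  have h7 : fderiv ℝ (fun x : ℝ × E => (-(r x.1 * deriv r x.1) * H x.2 V.2 W.2,
      christoffel H x.2 V.2 W.2 + (deriv r x.1 / r x.1) • (V.1 • W.2 + W.1 • V.2))) y = _ :=
    ((h4.mul h3).prodMk (h6.add (h5.smul_const (V.1 • W.2 + W.1 • V.2)))).fderiv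
  rw [he.fderiv_eq, h7]
  refine Prod.ext ?_ ?_
  · simp
    ring
  · simp [sq]

/-- By `trace_prod_eq`, the trace over `ℝ × E` sees only this component and the one in the next
lemma. -/
theorem curvature_warpedForm_fst [FiniteDimensional ℝ E] (hr : ContDiffAt ℝ ∞ r y.1)
    (hr0 : r y.1 ≠ 0) (hH : ContDiffAt ℝ ∞ H y.2) (hi : (H y.2).IsInvertible) (V W : ℝ × E) :
    (curvature (warpedForm r H) y (1, 0) V W).1 =
      -(r y.1 * deriv (deriv r) y.1) * H y.2 V.2 W.2 := by
  have hrd : DifferentiableAt ℝ r y.1 :=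
    hr.differentiableAt (by simp)
  have hHd : DifferentiableAt ℝ H y.2 := hH.differentiableAt (by simp)
  have h0 : ∀ w, christoffel H y.2 0 w = 0 := fun w => by
    simpa using christoffel_smul_left hHd 0 0 w
  simp only [curvature, fderiv_christoffel_warpedForm hr hr0 hH hi,
    christoffel_warpedForm hrd hr0 hHd hi]
  simp [h0]
  field_simp
  ring

theorem curvature_warpedForm_snd [FiniteDimensional ℝ E] (hr : ContDiffAt ℝ ∞ r y.1)
    (hr0 : r y.1 ≠ 0) (hH : ContDiffAt ℝ ∞ H y.2) (hi : (H y.2).IsInvertible)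
    (hs : ∀ x u v, H x u v = H x v u) (u : E) (V W : ℝ × E) :
    (curvature (warpedForm r H) y (0, u) V W).2 =
      curvature H y.2 u V.2 W.2
        - (V.1 * W.1 * deriv (deriv r) y.1 / r y.1 + deriv r y.1 ^ 2 * H y.2 V.2 W.2) • u
        + (deriv r y.1 ^ 2 * H y.2 u W.2) • V.2 := by
  have hrd : DifferentiableAt ℝ r y.1 :=
    hr.differentiableAt (by simp)
  have hHd : DifferentiableAt ℝ H y.2 := hH.differentiableAt (by simp)
  simp only [curvature, fderiv_christoffel_warpedForm hr hr0 hH hi,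
    christoffel_warpedForm hrd hr0 hHd hi, christoffel_add_right hHd hs,
    christoffel_smul_right hHd hs]
  simp [christoffel_comm hs u V.2]
  match_scalars <;> field_simp <;> ring

theorem coordRicci_warpedForm [FiniteDimensional ℝ E] (hr : ContDiffAt ℝ ∞ r y.1)
    (hr0 : r y.1 ≠ 0) (hH : ContDiffAt ℝ ∞ H y.2) (hi : (H y.2).IsInvertible)
    (hs : ∀ x u v, H x u v = H x v u) (V W : ℝ × E) :
    coordRicci (warpedForm r H) y V W =
      -(Module.finrank ℝ E * deriv (deriv r) y.1 / r y.1) * (V.1 * W.1) +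
        (coordRicci H y.2 V.2 W.2 - (r y.1 * deriv (deriv r) y.1 +
          ((Module.finrank ℝ E : ℝ) - 1) * deriv r y.1 ^ 2) * H y.2 V.2 W.2) := by
  have : CompleteSpace E := FiniteDimensional.complete ℝ E
  rw [coordRicci_eq_trace (contDiffAt_warpedForm hr hH) (isInvertible_warpedForm hr0 hi)
    (warpedForm_comm hs), trace_prod_eq, coordRicci_eq_trace hH hi hs]
  -- The `E` block is the curvature of `H`, plus a multiple of the identity, plus a rank-one map.
  -- The trace of the last is `r'² H(V, W)`, which turns the factor `dim E` of `r'²` into `dim E -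
  -- 1`.
  have h1 : LinearMap.snd ℝ ℝ E ∘ₗ curvatureMap (contDiffAt_warpedForm hr hH)
      (isInvertible_warpedForm hr0 hi) (warpedForm_comm hs) V W ∘ₗ LinearMap.inr ℝ ℝ E =
      curvatureMap hH hi hs V.2 W.2
        - (V.1 * W.1 * deriv (deriv r) y.1 / r y.1 + deriv r y.1 ^ 2 * H y.2 V.2 W.2) •
          LinearMap.id
        + deriv r y.1 ^ 2 • ((H y.2).flip W.2 : E →ₗ[ℝ] ℝ).smulRight V.2 := by
    refine LinearMap.ext fun u => ?_
    have h := curvature_warpedForm_snd hr hr0 hH hi hs u V W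
    rw [mul_smul] at h
    exact h
  have h2 : (curvatureMap (contDiffAt_warpedForm hr hH) (isInvertible_warpedForm hr0 hi)
      (warpedForm_comm hs) V W (1, 0)).1 = _ := curvature_warpedForm_fst hr hr0 hH hi V W
  rw [h1, h2]
  simp
  ring

theorem coordHessian_warpedForm [FiniteDimensional ℝ E] {f : ℝ → ℝ} (hf : ContDiffAt ℝ ∞ f y.1)
    (hr : DifferentiableAt ℝ r y.1)
    (hr0 : r y.1 ≠ 0) (hH : DifferentiableAt ℝ H y.2) (hi : (H y.2).IsInvertible) (U V : ℝ × E) :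
    coordHessian (warpedForm r H) (fun x => f x.1) y U V =
      deriv (deriv f) y.1 * (U.1 * V.1) + r y.1 * deriv r y.1 * deriv f y.1 * H y.2 U.2 V.2 := by
  have h1 : ∀ x : ℝ × E, DifferentiableAt ℝ f x.1 → HasFDerivAt (fun x : ℝ × E => f x.1)
      (deriv f x.1 • ContinuousLinearMap.fst ℝ ℝ E) x := fun x hx =>
    HasDerivAt.comp_hasFDerivAt x hx.hasDerivAt hasFDerivAt_fst
  have h2 : (fun x : ℝ × E => fderiv ℝ (fun x : ℝ × E => f x.1) x V) =ᶠ[𝓝 y]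
      fun x => deriv f x.1 * V.1 := by
    filter_upwards [continuousAt_fst.eventually (eventually_differentiableAt hf)] with x hx
    rw [(h1 x hx).fderiv]
    simp
  have h3 : HasFDerivAt (fun x : ℝ × E => deriv f x.1)
      (deriv (deriv f) y.1 • ContinuousLinearMap.fst ℝ ℝ E) y :=
    HasDerivAt.comp_hasFDerivAt (h₂ := deriv f) y
      ((contDiffAt_deriv hf).differentiableAt (by simp)).hasDerivAt hasFDerivAt_fst
  rw [coordHessian, h2.fderiv_eq, (h3.mul_const V.1).fderiv,
    (h1 y (hf.differentiableAt (by simp))).fderiv, christoffel_warpedForm hr hr0 hH hi]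
  simp
  ring

end WarpedCoordinates

/-! ### The metric in the preferred chart. -/

section ChartMetric

variable {E : Type*} [NormedAddCommGroup E] [NormedSpace ℝ E]
  {H : Type*} [TopologicalSpace H] {I : ModelWithCorners ℝ E H}
  {M : Type*} [TopologicalSpace M] [ChartedSpace H M] [IsManifold I ∞ M]

theorem chartMetric_apply (g : ContMDiffRiemannianMetric I ∞ E (fun x : M => TangentSpace I x))
    (p : M) (y u v : E) : chartMetric g p y u v = g.inner ((extChartAt I p).symm y)
      (mfderiv 𝓘(ℝ, E) I (extChartAt I p).symm y u)
      (mfderiv 𝓘(ℝ, E) I (extChartAt I p).symm y v) := rfl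

theorem chartMetric_comm (g : ContMDiffRiemannianMetric I ∞ E (fun x : M => TangentSpace I x))
    (p : M) (y u v : E) : chartMetric g p y u v = chartMetric g p y v u :=
  g.symm _ _ _

theorem chartDiff_apply (p : M) (u : TangentSpace I p) : chartDiff I p u = u := by
  have : IsManifold I 1 M := IsManifold.of_le (n := ∞) (by exact_mod_cast le_top)
  rw [chartDiff, mfderiv_extChartAt_self]; rfl

variable [I.Boundaryless]

theorem chartMetric_self (g : ContMDiffRiemannianMetric I ∞ E (fun x : M => TangentSpace I x))
    (p : M) (u v : E) : chartMetric g p (extChartAt I p p) u v = g.inner p u v := by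
  have : IsManifold I 1 M := IsManifold.of_le (n := ∞) (by exact_mod_cast le_top)
  have h := mfderivWithin_range_extChartAt_symm (I := I) (x := p)
  rw [I.range_eq_univ, mfderivWithin_univ] at h
  have hA : ∀ w : E, (mfderiv 𝓘(ℝ, E) I (extChartAt I p).symm (extChartAt I p p) w : E) = w :=
    fun w => DFunLike.congr_fun h w
  -- The point `φ⁻¹(φ(p))` equals `p` only propositionally and the tangent space depends on it, so
  -- the base point is generalized before substituting.
  have hq : ∀ q, q = p → ∀ u' v' : E, u' = u → v' = v → g.inner q u' v' = g.inner p u v := by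
    rintro q rfl u' v' rfl rfl
    rfl
  exact hq _ (extChartAt_to_inv p) _ _ (hA u) (hA v)

theorem isInvertible_chartMetric [FiniteDimensional ℝ E]
    (g : ContMDiffRiemannianMetric I ∞ E (fun x : M => TangentSpace I x)) (p : M) :
    (chartMetric g p (extChartAt I p p)).IsInvertible := by
  refine isInvertible_of_nondegenerate fun v hv => ?_
  by_contra hv0
  have := g.pos p v hv0
  have h := hv v
  rw [chartMetric_self] at h
  exact this.ne' h

/-- Smoothness of `g` is smoothness in the trivialization at `p`, whose inverse on fibres is the
differential of the inverse chart; so the two local expressions agree. -/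
theorem contDiffAt_chartMetric
    (g : ContMDiffRiemannianMetric I ∞ E (fun x : M => TangentSpace I x)) (p : M) :
    ContDiffAt ℝ ∞ (chartMetric g p) (extChartAt I p p) := by
  have : IsManifold I 1 M := IsManifold.of_le (n := ∞) (by exact_mod_cast le_top)
  have h1 := ((contMDiffAt_hom_bundle _).1 (g.contMDiff p)).2
  have h2 : ContMDiffAt 𝓘(ℝ, E) I ∞ (extChartAt I p).symm (extChartAt I p p) :=
    (contMDiffOn_extChartAt_symm p).contMDiffAt (extChartAt_target_mem_nhds p)
  rw [← contMDiffAt_iff_contDiffAt]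
  refine (ContMDiffAt.comp_of_eq h1 h2 (by simp)).congr_of_eventuallyEq ?_
  filter_upwards [extChartAt_target_mem_nhds (I := I) p] with y hy
  have hy' : (extChartAt I p).symm y ∈ (chartAt H p).source := by
    simpa using (extChartAt I p).map_target hy
  have hb : (extChartAt I p).symm y ∈ (trivializationAt E (TangentSpace I) p).baseSet := hy'
  refine ContinuousLinearMap.ext fun u => ContinuousLinearMap.ext fun v => ?_
  have hA : ∀ w : E, (trivializationAt E (TangentSpace I) p).symm ((extChartAt I p).symm y) w =
      mfderiv 𝓘(ℝ, E) I (extChartAt I p).symm y w := by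
    intro w
    have := TangentBundle.symmL_trivializationAt (𝕜 := ℝ) (I := I) hy'
    rw [I.range_eq_univ, mfderivWithin_univ, (extChartAt I p).right_inv hy] at this
    rw [← this]
    exact (Trivialization.symmL_apply (R := ℝ) _ hb w).symm
  rw [Function.comp_apply, inCoordinates_apply_eq₂ hb hb (by simp), hA, hA]
  simp [chartMetric_apply]

end ChartMetric

/-! ### The warped metric in a product chart. -/

section WarpedChart

variable {E : Type*} [NormedAddCommGroup E] [NormedSpace ℝ E]
  {N : Type*} [TopologicalSpace N] [ChartedSpace E N]
  (J : TopologicalSpace.Opens ℝ)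

theorem coe_fst_extChartAt_symm {p : J × N} {y : ℝ × E}
    (hy : y ∈ (extChartAt (𝓘(ℝ, ℝ).prod 𝓘(ℝ, E)) p).target) :
    (((extChartAt (𝓘(ℝ, ℝ).prod 𝓘(ℝ, E)) p).symm y).1 : ℝ) = y.1 :=
  congrArg Prod.fst ((extChartAt (𝓘(ℝ, ℝ).prod 𝓘(ℝ, E)) p).right_inv hy)

variable [IsManifold 𝓘(ℝ, E) ∞ N]

/-- The chart of `J × N` is the inclusion of `J` times a chart of `N`. Under the inverse chart, `dS`
thus becomes the first projection, and `dN` the differential of the inverse chart of `N` after the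
second projection (`hS`, `hN`). -/
theorem chartMetric_warpedMetric [FiniteDimensional ℝ E] (r : ℝ → ℝ) (hr : ContDiffOn ℝ ∞ r J)
    (hpos : ∀ s ∈ J, 0 < r s)
    (h : ContMDiffRiemannianMetric 𝓘(ℝ, E) ∞ E (fun x : N => TangentSpace 𝓘(ℝ, E) x))
    (p : J × N) :
    chartMetric (warpedMetric J r hr hpos h) p
      =ᶠ[𝓝 (extChartAt (𝓘(ℝ, ℝ).prod 𝓘(ℝ, E)) p p)] warpedForm r (chartMetric h p.2) := by
  set φ := extChartAt (𝓘(ℝ, ℝ).prod 𝓘(ℝ, E)) p with hφ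
  have hfst : ∀ y ∈ φ.target, ((φ.symm y).1 : ℝ) = y.1 := fun y hy => coe_fst_extChartAt_symm J hy
  have ho : IsOpen φ.target := isOpen_extChartAt_target p
  filter_upwards [extChartAt_target_mem_nhds (I := 𝓘(ℝ, ℝ).prod 𝓘(ℝ, E)) p] with y hy
  have hd : MDifferentiableAt 𝓘(ℝ, ℝ × E) (𝓘(ℝ, ℝ).prod 𝓘(ℝ, E)) φ.symm y :=
    ((contMDiffOn_extChartAt_symm (I := 𝓘(ℝ, ℝ).prod 𝓘(ℝ, E)) (n := ∞) p).contMDiffAt (ho.mem_nhds hy)).mdifferentiableAt (by simp)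
  have hy2 : y.2 ∈ (extChartAt 𝓘(ℝ, E) p.2).target := by
    rw [extChartAt_prod] at hy
    exact hy.2
  have hd2 : MDifferentiableAt 𝓘(ℝ, E) 𝓘(ℝ, E) (extChartAt 𝓘(ℝ, E) p.2).symm y.2 :=
    ((contMDiffOn_extChartAt_symm (n := ∞) p.2).contMDiffAt
      ((isOpen_extChartAt_target p.2).mem_nhds hy2)).mdifferentiableAt (by simp)
  have h1 : ContMDiff (𝓘(ℝ, ℝ).prod 𝓘(ℝ, E)) 𝓘(ℝ, ℝ) ∞ (fun q : J × N => (q.1 : ℝ)) :=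
    contMDiff_subtype_val.comp contMDiff_fst
  have hS : ∀ U : ℝ × E, dS J (φ.symm y) (mfderiv 𝓘(ℝ, ℝ × E) (𝓘(ℝ, ℝ).prod 𝓘(ℝ, E)) φ.symm y U)
      = U.1 := by
    intro U
    have h2 := HasMFDerivAt.comp y ((h1.mdifferentiable (by simp)) (φ.symm y)).hasMFDerivAt
      hd.hasMFDerivAt
    have h3 : HasMFDerivAt 𝓘(ℝ, ℝ × E) 𝓘(ℝ, ℝ) ((fun q : J × N => (q.1 : ℝ)) ∘ φ.symm) y
        (ContinuousLinearMap.fst ℝ ℝ E) :=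
      (hasFDerivAt_fst.hasMFDerivAt).congr_of_eventuallyEq
        (Filter.eventually_of_mem (ho.mem_nhds hy) hfst)
    exact DFunLike.congr_fun (hasMFDerivAt_unique h2 h3) U
  have hN : ∀ U : ℝ × E, dN J (φ.symm y) (mfderiv 𝓘(ℝ, ℝ × E) (𝓘(ℝ, ℝ).prod 𝓘(ℝ, E)) φ.symm y U)
      = mfderiv 𝓘(ℝ, E) 𝓘(ℝ, E) (extChartAt 𝓘(ℝ, E) p.2).symm y.2 U.2 := by
    intro U
    have h2 := HasMFDerivAt.comp y (mdifferentiableAt_snd (I := 𝓘(ℝ, ℝ)) (I' := 𝓘(ℝ, E))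
      (x := φ.symm y)).hasMFDerivAt hd.hasMFDerivAt
    have h3 : HasMFDerivAt 𝓘(ℝ, ℝ × E) 𝓘(ℝ, E) ((Prod.snd : J × N → N) ∘ φ.symm) y
        (mfderiv 𝓘(ℝ, E) 𝓘(ℝ, E) (extChartAt 𝓘(ℝ, E) p.2).symm y.2 ∘L
          ContinuousLinearMap.snd ℝ ℝ E) :=
      HasMFDerivAt.comp (f := (Prod.snd : ℝ × E → E)) y hd2.hasMFDerivAt
        (hasFDerivAt_snd.hasMFDerivAt)
    exact DFunLike.congr_fun (hasMFDerivAt_unique h2 h3) U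
  refine ContinuousLinearMap.ext fun U => ContinuousLinearMap.ext fun V => ?_
  rw [warpedForm_apply, chartMetric_apply, ← hfst y hy]
  refine (warpedInner_apply J r h (φ.symm y) _ _).trans ?_
  rw [hS, hS, hN, hN]
  rfl

end WarpedChart

/-! ### Ricci, Hessian, Laplacian and scalar curvature of the warped product. -/

section WarpedGeometry

variable {E : Type*} [NormedAddCommGroup E] [NormedSpace ℝ E] [FiniteDimensional ℝ E]

theorem metricTrace_warpedForm {r : ℝ → ℝ} {H : E → E →L[ℝ] E →L[ℝ] ℝ} {y : ℝ × E}
    (hr0 : r y.1 ≠ 0) (hi : (H y.2).IsInvertible) (hs : ∀ x u v, H x u v = H x v u)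
    {B : ℝ × E → ℝ × E → ℝ} (α β : ℝ)
    (hB : ∀ U V, B U V = α * (U.1 * V.1) + β * H y.2 U.2 V.2) :
    metricTrace (warpedForm r H y) B = α + Module.finrank ℝ E * (β / r y.1 ^ 2) := by
  rw [metricTrace_eq_trace (isInvertible_warpedForm hr0 hi) (warpedForm_comm hs y)
    ((α • LinearMap.id).prodMap ((β / r y.1 ^ 2) • LinearMap.id)), trace_prod_eq]
  · have : LinearMap.snd ℝ ℝ E ∘ₗ ((α • LinearMap.id).prodMap ((β / r y.1 ^ 2) • LinearMap.id)) ∘ₗ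
        LinearMap.inr ℝ ℝ E = (β / r y.1 ^ 2) • LinearMap.id := by
      ext u
      simp
    rw [this]
    simp
    ring
  · intro U V
    rw [hB, warpedForm_apply]
    simp
    field_simp

theorem ricci_eq_coordRicci {H : Type*} [TopologicalSpace H] {I : ModelWithCorners ℝ E H}
    {M : Type*} [TopologicalSpace M] [ChartedSpace H M] [IsManifold I ∞ M]
    (g : ContMDiffRiemannianMetric I ∞ E (fun x : M => TangentSpace I x)) (p : M)
    (u v : TangentSpace I p) :
    ricci g p u v = coordRicci (chartMetric g p) (extChartAt I p p) u v := by
  rw [ricci, chartDiff_apply, chartDiff_apply]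

variable {N : Type*} [TopologicalSpace N] [ChartedSpace E N] [IsManifold 𝓘(ℝ, E) ∞ N]
  {J : TopologicalSpace.Opens ℝ} {r : ℝ → ℝ} (hr : ContDiffOn ℝ ∞ r J)
  (hpos : ∀ s ∈ J, 0 < r s)
  (h : ContMDiffRiemannianMetric 𝓘(ℝ, E) ∞ E (fun x : N => TangentSpace 𝓘(ℝ, E) x))
  (p : J × N) (U V : TangentSpace (𝓘(ℝ, ℝ).prod 𝓘(ℝ, E)) p)

theorem warpedMetric_inner_apply : (warpedMetric J r hr hpos h).inner p U V =
    U.1 * V.1 + r p.1 ^ 2 * h.inner p.2 U.2 V.2 := by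
  refine (warpedInner_apply J r h p U V).trans ?_
  rw [dS_apply, dS_apply, dN_apply, dN_apply]

theorem ricci_warpedMetric : ricci (warpedMetric J r hr hpos h) p U V =
    -(Module.finrank ℝ E * deriv (deriv r) p.1 / r p.1) * (U.1 * V.1) +
      (ricci h p.2 U.2 V.2 - (r p.1 * deriv (deriv r) p.1 +
        ((Module.finrank ℝ E : ℝ) - 1) * deriv r p.1 ^ 2) * h.inner p.2 U.2 V.2) := by
  rw [ricci_eq_coordRicci, coordRicci_congr (chartMetric_warpedMetric J r hr hpos h p)]
  refine (coordRicci_warpedForm (y := extChartAt (𝓘(ℝ, ℝ).prod 𝓘(ℝ, E)) p p)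
    (hr.contDiffAt (J.isOpen.mem_nhds p.1.2))
    (hpos _ p.1.2).ne' (contDiffAt_chartMetric h p.2) (isInvertible_chartMetric h p.2)
    (chartMetric_comm h p.2) U V).trans ?_
  have h1 := ricci_eq_coordRicci h p.2 U.2 V.2
  rw [h1, ← chartMetric_self h p.2 U.2 V.2]
  rfl

variable {lam : ℝ → ℝ}

theorem coordHessian_warpedMetric (hlam : ContDiffOn ℝ ∞ lam J) (U V : ℝ × E) :
    coordHessian (chartMetric (warpedMetric J r hr hpos h) p)
      ((fun p : J × N => lam p.1) ∘ (extChartAt (𝓘(ℝ, ℝ).prod 𝓘(ℝ, E)) p).symm)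
      (extChartAt (𝓘(ℝ, ℝ).prod 𝓘(ℝ, E)) p p) U V =
    deriv (deriv lam) p.1 * (U.1 * V.1) + r p.1 * deriv r p.1 * deriv lam p.1 *
      chartMetric h p.2 (extChartAt 𝓘(ℝ, E) p.2 p.2) U.2 V.2 := by
  have hf : ((fun p : J × N => lam p.1) ∘ (extChartAt (𝓘(ℝ, ℝ).prod 𝓘(ℝ, E)) p).symm) =ᶠ[𝓝
      (extChartAt (𝓘(ℝ, ℝ).prod 𝓘(ℝ, E)) p p)] fun y => lam y.1 := by
    filter_upwards [extChartAt_target_mem_nhds (I := 𝓘(ℝ, ℝ).prod 𝓘(ℝ, E)) p] with y hy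
    exact congrArg lam (coe_fst_extChartAt_symm J hy)
  rw [coordHessian_congr (chartMetric_warpedMetric J r hr hpos h p) hf]
  exact coordHessian_warpedForm (y := extChartAt (𝓘(ℝ, ℝ).prod 𝓘(ℝ, E)) p p)
    (hlam.contDiffAt (J.isOpen.mem_nhds p.1.2))
    ((hr.contDiffAt (J.isOpen.mem_nhds p.1.2)).differentiableAt (by simp))
    (hpos _ p.1.2).ne' ((contDiffAt_chartMetric h p.2).differentiableAt (by simp))
    (isInvertible_chartMetric h p.2) U V

theorem hessian_warpedMetric (hlam : ContDiffOn ℝ ∞ lam J) :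
    hessian (warpedMetric J r hr hpos h) (fun p : J × N => lam p.1) p U V =
    deriv (deriv lam) p.1 * (U.1 * V.1) +
      r p.1 * deriv r p.1 * deriv lam p.1 * h.inner p.2 U.2 V.2 := by
  rw [hessian, chartDiff_apply, chartDiff_apply, ← chartMetric_self h p.2 U.2 V.2]
  exact coordHessian_warpedMetric hr hpos h p hlam U V

theorem laplacian_warpedMetric (hlam : ContDiffOn ℝ ∞ lam J) :
    laplacian (warpedMetric J r hr hpos h) (fun p : J × N => lam p.1) p =
    deriv (deriv lam) p.1 + Module.finrank ℝ E * (deriv r p.1 / r p.1 * deriv lam p.1) := by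
  have h0 : r p.1 ≠ 0 := (hpos _ p.1.2).ne'
  rw [laplacian, (chartMetric_warpedMetric J r hr hpos h p).eq_of_nhds]
  refine (metricTrace_warpedForm (y := extChartAt (𝓘(ℝ, ℝ).prod 𝓘(ℝ, E)) p p) h0
    (isInvertible_chartMetric h p.2) (chartMetric_comm h p.2) _ _
    (coordHessian_warpedMetric hr hpos h p hlam)).trans ?_
  change _ + _ * (_ / r p.1 ^ 2) = _
  field_simp

theorem scalarCurvature_warpedMetric {c : ℝ}
    (hc : ∀ u v, ricci h p.2 u v = c * h.inner p.2 u v) :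
    scalarCurvature (warpedMetric J r hr hpos h) p =
    -(2 * Module.finrank ℝ E * deriv (deriv r) p.1 / r p.1) +
      Module.finrank ℝ E * (c - ((Module.finrank ℝ E : ℝ) - 1) * deriv r p.1 ^ 2) / r p.1 ^ 2 := by
  have h0 : r p.1 ≠ 0 := (hpos _ p.1.2).ne'
  rw [scalarCurvature, (chartMetric_warpedMetric J r hr hpos h p).eq_of_nhds]
  refine (metricTrace_warpedForm (y := extChartAt (𝓘(ℝ, ℝ).prod 𝓘(ℝ, E)) p p) h0
    (isInvertible_chartMetric h p.2) (chartMetric_comm h p.2)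
    (-(Module.finrank ℝ E * deriv (deriv r) p.1 / r p.1)) (c - (r p.1 * deriv (deriv r) p.1 +
        ((Module.finrank ℝ E : ℝ) - 1) * deriv r p.1 ^ 2)) fun U V => ?_).trans ?_
  · have h1 := (ricci_eq_coordRicci (warpedMetric J r hr hpos h) p U V).symm.trans
      (ricci_warpedMetric hr hpos h p U V)
    rw [hc U.2 V.2, ← sub_mul, ← chartMetric_self h p.2 U.2 V.2] at h1
    exact h1
  · change _ + _ * (_ / r p.1 ^ 2) = _
    field_simp
    ring

/-- Decouples `s`, `x` and the two components of each tangent vector, so that they can be varied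
independently. -/
theorem satisfiesCriticalEquation_warpedMetric_iff (hlam : ContDiffOn ℝ ∞ lam J) :
    SatisfiesCriticalEquation (warpedMetric J r hr hpos h) (fun p : J × N => lam p.1) ↔
      ∀ s ∈ J, ∀ (x : N) (a b : ℝ) (u v : TangentSpace 𝓘(ℝ, E) x),
        -(deriv (deriv lam) s + Module.finrank ℝ E * (deriv r s / r s * deriv lam s)) *
            (a * b + r s ^ 2 * h.inner x u v) +
          (deriv (deriv lam) s * (a * b) + r s * deriv r s * deriv lam s * h.inner x u v) -
          lam s * (-(Module.finrank ℝ E * deriv (deriv r) s / r s) * (a * b) +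
            (ricci h x u v - (r s * deriv (deriv r) s +
              ((Module.finrank ℝ E : ℝ) - 1) * deriv r s ^ 2) * h.inner x u v)) =
        a * b + r s ^ 2 * h.inner x u v := by
  have key : ∀ (p : J × N) (U V : TangentSpace (𝓘(ℝ, ℝ).prod 𝓘(ℝ, E)) p), _ := fun p U V => by
    have h1 := laplacian_warpedMetric hr hpos h p hlam
    have h2 := hessian_warpedMetric hr hpos h p U V hlam
    have h3 := ricci_warpedMetric hr hpos h p U V
    have h4 := warpedMetric_inner_apply hr hpos h p U V
    exact And.intro h1 (And.intro h2 (And.intro h3 h4))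
  constructor
  · intro hc s hs x a b u v
    have h0 := hc (⟨s, hs⟩, x) (a, u) (b, v)
    obtain ⟨h1, h2, h3, h4⟩ := key (⟨s, hs⟩, x) (a, u) (b, v)
    rw [h1, h2, h3, h4] at h0
    exact h0
  · intro hc p U V
    obtain ⟨h1, h2, h3, h4⟩ := key p U V
    rw [h1, h2, h3, h4]
    exact hc p.1 p.1.2 p.2 U.1 V.1 U.2 V.2

end WarpedGeometry

/-! ### The ordinary differential equations for `r` and `λ`. -/

section WarpingFunction

variable {J : Set ℝ} {r lam : ℝ → ℝ} {k κ a : ℝ} {l : ℕ}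

/-- If the scalar curvature of a warped product over an interval is constant, then the warping
function has a conserved quantity. -/
theorem exists_eq_of_scalar_eq (hJ : IsOpen J) (hc : J.OrdConnected)
    (hr : ContDiffOn ℝ ∞ r J) (hpos : ∀ s ∈ J, 0 < r s) (hl : 0 < l)
    (h : ∀ s ∈ J, 2 * r s * deriv (deriv r) s + l * deriv r s ^ 2 + (l + 2) * k * r s ^ 2
      = l * κ) :
    ∃ a : ℝ, ∀ s ∈ J, deriv (deriv r) s + k * r s = a * (r s ^ (l + 1))⁻¹ ∧
      deriv r s ^ 2 + k * r s ^ 2 + 2 * a / l * (r s ^ l)⁻¹ = κ := by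
  have hl' : (l : ℝ) ≠ 0 := by positivity
  -- This derivative is `r^l / 2` times the derivative of the left-hand side of `h`, which is
  -- constant on `J`.
  have hA : ∀ s ∈ J, HasDerivAt (fun s => (deriv (deriv r) s + k * r s) * r s ^ (l + 1)) 0 s := by
    intro s hs
    have h0 := hr.contDiffAt (hJ.mem_nhds hs)
    have d0 := (h0.differentiableAt (by simp)).hasDerivAt
    have d1 := ((contDiffAt_deriv h0).differentiableAt (by simp)).hasDerivAt
    have d2 := ((contDiffAt_deriv (contDiffAt_deriv h0)).differentiableAt (by simp)).hasDerivAt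
    have e1 := (((d0.const_mul 2).mul d2).add ((d1.pow 2).const_mul (l : ℝ))).add
      ((d0.pow 2).const_mul ((l + 2) * k))
    have e2 : HasDerivAt (fun _ : ℝ => l * κ) 0 s := hasDerivAt_const _ _
    have e3 := e1.unique (e2.congr_of_eventuallyEq (Filter.eventually_of_mem (hJ.mem_nhds hs)
      fun t ht => by simpa only [Pi.add_apply, Pi.mul_apply, Pi.pow_apply] using h t ht))
    convert! (d2.add (d0.const_mul k)).mul (d0.pow (l + 1)) using 1
    simp at e3 ⊢
    linear_combination (-(r s ^ l) / 2) * e3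
  obtain ⟨a, ha⟩ := hJ.exists_is_const_of_deriv_eq_zero hc.isPreconnected
    (fun s hs => (hA s hs).differentiableAt.differentiableWithinAt) (fun s hs => (hA s hs).deriv)
  refine ⟨a, fun s hs => ?_⟩
  have hs0 := (hpos s hs).ne'
  have h1 : deriv (deriv r) s + k * r s = a * (r s ^ (l + 1))⁻¹ := by
    rw [← ha s hs]
    field_simp
  refine ⟨h1, ?_⟩
  have h2 : a * (r s ^ l)⁻¹ = r s * (deriv (deriv r) s + k * r s) := by
    rw [h1]
    field_simp
    ring
  have h3 := h s hs
  rw [mul_div_right_comm, mul_assoc, h2]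
  field_simp
  linear_combination h3

/-- Differentiating `h2` gives `r' λ'' - r''' λ = -r' / (l + 1)`, and differentiating `h1` shows
that `r'''` is a multiple of `r'`. Together they give `r' D = 0`. -/
theorem deriv_deriv_eq_of_first_order (hJ : IsOpen J)
    (hr : ContDiffOn ℝ ∞ r J) (hpos : ∀ s ∈ J, 0 < r s) (hlam : ContDiffOn ℝ ∞ lam J)
    (h1 : ∀ s ∈ J, deriv (deriv r) s + k * r s = a * (r s ^ (l + 1))⁻¹)
    (h2 : ∀ s ∈ J, deriv r s * deriv lam s - deriv (deriv r) s * lam s = -(1 / (l + 1)) * r s)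
    {s : ℝ} (hs : s ∈ J) :
    deriv (deriv lam) s + k * lam s + (l + 1) * a * (r s ^ (l + 2))⁻¹ * lam s + 1 / (l + 1) = 0 := by
  set D : ℝ → ℝ := fun s =>
    deriv (deriv lam) s + k * lam s + (l + 1) * a * (r s ^ (l + 2))⁻¹ * lam s + 1 / (l + 1) with hD
  have hmul : ∀ s ∈ J, deriv r s * D s = 0 := by
    intro s hs
    have hs0 := (hpos s hs).ne'
    have h0 := hr.contDiffAt (hJ.mem_nhds hs)
    have d0 := (h0.differentiableAt (by simp)).hasDerivAt
    have d1 := ((contDiffAt_deriv h0).differentiableAt (by simp)).hasDerivAt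
    have d2 := ((contDiffAt_deriv (contDiffAt_deriv h0)).differentiableAt (by simp)).hasDerivAt
    have l0 := hlam.contDiffAt (hJ.mem_nhds hs)
    have f0 := (l0.differentiableAt (by simp)).hasDerivAt
    have f1 := ((contDiffAt_deriv l0).differentiableAt (by simp)).hasDerivAt
    have e1 := (d2.add (d0.const_mul k)).unique
      ((((d0.pow (l + 1)).inv (pow_ne_zero _ hs0)).const_mul a).congr_of_eventuallyEq
        (Filter.eventually_of_mem (hJ.mem_nhds hs) h1))
    have e2 := ((d1.mul f1).sub (d2.mul f0)).unique
      ((d0.const_mul (-(1 / ((l : ℝ) + 1)))).congr_of_eventuallyEq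
        (Filter.eventually_of_mem (hJ.mem_nhds hs) h2))
    have e3 : deriv (deriv (deriv r)) s =
        -k * deriv r s - (l + 1) * a * (r s ^ (l + 2))⁻¹ * deriv r s := by
      rw [← add_right_cancel_iff (a := k * deriv r s), e1]
      simp
      field_simp
      ring
    rw [e3] at e2
    simp only [hD]
    linear_combination e2
  have hcont : ContinuousAt D s := by
    have c0 := (hr.contDiffAt (hJ.mem_nhds hs)).continuousAt
    have l0 := hlam.contDiffAt (hJ.mem_nhds hs)
    have c1 := (contDiffAt_deriv (contDiffAt_deriv l0)).continuousAt
    have c2 := l0.continuousAt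
    exact ((c1.add (c2.const_mul k)).add
      ((((c0.pow (l + 2)).inv₀ (pow_ne_zero _ (hpos s hs).ne')).const_mul _).mul c2)).add_const _
  -- At a zero of `r'`, `h2` forces `r'' ≠ 0`, so the zero is isolated; `D` vanishes on a punctured
  -- neighbourhood and hence, by continuity, at `s`.
  by_cases hr' : deriv r s = 0
  · have h3 := h2 s hs
    have h4 : deriv (deriv r) s ≠ 0 := by
      intro h4
      rw [hr', h4] at h3
      have : (1 / ((l : ℝ) + 1)) * r s > 0 := mul_pos (by positivity) (hpos s hs)
      linarith
    have d1 := ((contDiffAt_deriv (hr.contDiffAt (hJ.mem_nhds hs))).differentiableAt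
      (by simp)).hasDerivAt
    have h5 : ∀ᶠ t in 𝓝[≠] s, D t = 0 := by
      filter_upwards [d1.eventually_ne (c := 0) h4, nhdsWithin_le_nhds (hJ.mem_nhds hs)] with t ht hJt
      exact (mul_eq_zero.1 (hmul t hJt)).resolve_left ht
    exact tendsto_nhds_unique (hcont.tendsto.mono_left nhdsWithin_le_nhds)
      (tendsto_const_nhds.congr' (h5.mono fun t ht => ht.symm))
  · exact (mul_eq_zero.1 (hmul s hs)).resolve_left hr'

end WarpingFunction

end WarpedCritical

end

/-! ### The equivalence. -/

theorem mainTheorem4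
    {E : Type*} [NormedAddCommGroup E] [NormedSpace ℝ E] [FiniteDimensional ℝ E]
    {N : Type*} [TopologicalSpace N] [ChartedSpace E N] [IsManifold 𝓘(ℝ, E) ∞ N] [Nonempty N]
    (n : ℕ) (hn : 3 ≤ n) (hdim : Module.finrank ℝ E + 1 = n)
    (h : ContMDiffRiemannianMetric 𝓘(ℝ, E) ∞ E (fun x : N => TangentSpace 𝓘(ℝ, E) x))
    (J : TopologicalSpace.Opens ℝ) (hJ : (J : Set ℝ).OrdConnected) (hJne : (J : Set ℝ).Nonempty)
    (r : ℝ → ℝ) (hr : ContDiffOn ℝ ∞ r J) (hpos : ∀ s ∈ J, 0 < r s)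
    (lam : ℝ → ℝ) (hlam : ContDiffOn ℝ ∞ lam J) (R : ℝ) :
    ((∀ p : J × N,
          WarpedCritical.scalarCurvature (WarpedCritical.warpedMetric J r hr hpos h) p = R) ∧
        WarpedCritical.SatisfiesCriticalEquation (WarpedCritical.warpedMetric J r hr hpos h)
          (fun p : J × N => lam p.1)) ↔
      ((∃ κ₀ a : ℝ,
          (∀ (x : N) (u v : TangentSpace 𝓘(ℝ, E) x),
            WarpedCritical.ricci h x u v = ((n : ℝ) - 2) * κ₀ * h.inner x u v) ∧
          (∀ s ∈ J, deriv (deriv r) s + R / (n * ((n : ℝ) - 1)) * r s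
            = a * r s ^ (1 - (n : ℤ))) ∧
          (∀ s ∈ J, deriv r s ^ 2 + R / (n * ((n : ℝ) - 1)) * r s ^ 2
            + 2 * a / ((n : ℝ) - 2) * r s ^ (2 - (n : ℤ)) = κ₀)) ∧
        (∀ s ∈ J, deriv r s * deriv lam s - deriv (deriv r) s * lam s
            = -(1 / ((n : ℝ) - 1)) * r s)) := by
  obtain ⟨l, rfl⟩ : ∃ l, n = l + 2 := ⟨n - 2, by omega⟩
  have hl : 0 < l := by omega
  have hl' : (l : ℝ) ≠ 0 := by positivity
  have hfin : (Module.finrank ℝ E : ℝ) = l + 1 := by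
    have : Module.finrank ℝ E = l + 1 := by omega
    rw [this]; push_cast; ring
  have c1 : ((l + 2 : ℕ) : ℝ) - 1 = l + 1 := by push_cast; ring
  have c2 : ((l + 2 : ℕ) : ℝ) - 2 = l := by simp
  have z1 : ∀ t : ℝ, t ^ (1 - ((l + 2 : ℕ) : ℤ)) = (t ^ (l + 1))⁻¹ := fun t => by
    rw [← zpow_natCast, ← zpow_neg]; congr 1
  have z2 : ∀ t : ℝ, t ^ (2 - ((l + 2 : ℕ) : ℤ)) = (t ^ l)⁻¹ := fun t => by
    rw [← zpow_natCast, ← zpow_neg]; congr 1; simp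
  simp only [c1, c2, z1, z2]
  set k : ℝ := R / ((l + 2 : ℕ) * ((l : ℝ) + 1)) with hk
  have hR : R = (l + 2) * (l + 1) * k := by
    rw [hk]; push_cast; field_simp
  rw [WarpedCritical.satisfiesCriticalEquation_warpedMetric_iff hr hpos h hlam]
  have hscal : ∀ {κ : ℝ}, (∀ (x : N) (u v : TangentSpace 𝓘(ℝ, E) x),
      WarpedCritical.ricci h x u v = l * κ * h.inner x u v) → ∀ (s : ℝ) (hs : s ∈ J) (x : N),
      WarpedCritical.scalarCurvature (WarpedCritical.warpedMetric J r hr hpos h) (⟨s, hs⟩, x) = R ↔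
      2 * r s * deriv (deriv r) s + l * deriv r s ^ 2 + (l + 2) * k * r s ^ 2 = l * κ := by
    intro κ hκ s hs x
    have h0 := (hpos s hs).ne'
    rw [WarpedCritical.scalarCurvature_warpedMetric hr hpos h (⟨s, hs⟩, x) (hκ x), hR, hfin]
    change -(2 * ((l : ℝ) + 1) * deriv (deriv r) s / r s) + ((l : ℝ) + 1) * (l * κ -
      ((l : ℝ) + 1 - 1) * deriv r s ^ 2) / r s ^ 2 = _ ↔ _
    -- The defect in scalar curvature is a nonzero multiple of the defect in the equation for `r`.
    have e : -(2 * ((l : ℝ) + 1) * deriv (deriv r) s / r s) + ((l : ℝ) + 1) * (l * κ -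
        ((l : ℝ) + 1 - 1) * deriv r s ^ 2) / r s ^ 2 - (l + 2) * (l + 1) * k =
        ((l : ℝ) + 1) / r s ^ 2 * (l * κ -
          (2 * r s * deriv (deriv r) s + l * deriv r s ^ 2 + (l + 2) * k * r s ^ 2)) := by
      field_simp
      ring
    have hne : ((l : ℝ) + 1) / r s ^ 2 ≠ 0 := by positivity
    rw [← sub_eq_zero, e, mul_eq_zero, or_iff_right hne, sub_eq_zero, eq_comm]
  rw [hfin]
  constructor
  · rintro ⟨hs, hc⟩
    have hii : ∀ s ∈ J, deriv r s * deriv lam s - deriv (deriv r) s * lam s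
            = -(1 / ((l : ℝ) + 1)) * r s := by
      intro s hs
      obtain ⟨x⟩ := ‹Nonempty N›
      have h0 := (hpos s hs).ne'
      have e1 := hc s hs x 1 1 0 0
      -- Subtracting the equation at zero vectors removes the term `ricci h x 0 0` from `e1`,
      -- leaving the `ds²` component.
      have e2 := hc s hs x 0 0 0 0
      simp only [map_zero, mul_zero, mul_one, add_zero, zero_add, zero_sub] at e1 e2
      have e3 : -(((l : ℝ) + 1) * (deriv r s / r s * deriv lam s)) + lam s * ((l + 1) *
        deriv (deriv r) s / r s) = 1 := by linear_combination e1 - e2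
      field_simp at e3 ⊢
      linear_combination -e3
    obtain ⟨κ, hκ⟩ : ∃ κ : ℝ, ∀ (x : N) (u v : TangentSpace 𝓘(ℝ, E) x),
        WarpedCritical.ricci h x u v = l * κ * h.inner x u v := by
      obtain ⟨s, hs, hs0⟩ : ∃ s ∈ J, lam s ≠ 0 := by
        by_contra! hall
        obtain ⟨s, hs⟩ := hJne
        have h1 : deriv lam s = 0 := by
          have : lam =ᶠ[𝓝 s] fun _ => 0 := Filter.eventually_of_mem (J.isOpen.mem_nhds hs) hall
          rw [this.deriv_eq, deriv_const]
        have h2 := hii s hs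
        rw [h1, hall s hs] at h2
        have : (1 / ((l : ℝ) + 1)) * r s > 0 := mul_pos (by positivity) (hpos s hs)
        linarith
      -- The `N` component at this fixed `s`, solved for `Ric(h)`; the factor does not involve `x`.
      refine ⟨(-(deriv (deriv lam) s * r s ^ 2 + (l + 1) * (r s * deriv r s * deriv lam s)) +
        r s * deriv r s * deriv lam s + lam s * (r s * deriv (deriv r) s +
          l * deriv r s ^ 2) - r s ^ 2) / (lam s * l), fun x u v => ?_⟩
      have e := hc s hs x 0 0 u v
      have h0 := (hpos s hs).ne'
      have hq : deriv r s / r s * r s ^ 2 = r s * deriv r s := by field_simp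
      field_simp
      linear_combination -e - (l + 1) * deriv lam s * h.inner x u v * hq
    obtain ⟨a, ha⟩ := WarpedCritical.exists_eq_of_scalar_eq J.isOpen hJ hr hpos hl
      fun s hs' => (hscal hκ s hs' (Classical.arbitrary N)).1 (hs _)
    exact ⟨⟨κ, a, hκ, fun s hs => (ha s hs).1, fun s hs => (ha s hs).2⟩, hii⟩
  · rintro ⟨⟨κ, a, hκ, h1, h2⟩, hii⟩
    have hρ : ∀ s ∈ J, a * (r s ^ l)⁻¹ = r s * (deriv (deriv r) s + k * r s) := by
      intro s hs
      have h0 := (hpos s hs).ne'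
      rw [h1 s hs]
      field_simp
      ring
    have h2' : ∀ s ∈ J, 2 * r s * deriv (deriv r) s + l * deriv r s ^ 2 + (l + 2) * k * r s ^ 2
        = l * κ := by
      intro s hs
      have e := h2 s hs
      rw [mul_div_right_comm, mul_assoc, hρ s hs] at e
      field_simp at e
      linear_combination e
    refine ⟨fun p => (hscal hκ p.1 p.1.2 p.2).2 (h2' p.1 p.1.2), fun s hs x b c u v => ?_⟩
    have h0 := (hpos s hs).ne'
    have hD := WarpedCritical.deriv_deriv_eq_of_first_order J.isOpen hr hpos hlam h1 hii hs
    have hp : (r s ^ (l + 2))⁻¹ * r s ^ 2 = (r s ^ l)⁻¹ := by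
      field_simp
      ring
    -- The equation `D = 0` times `r²`, with `a` eliminated by means of `hρ`.
    have hD' : (deriv (deriv lam) s + k * lam s + 1 / (l + 1)) * r s ^ 2 +
        (l + 1) * (r s * (deriv (deriv r) s + k * r s)) * lam s = 0 := by
      rw [← hρ s hs]
      linear_combination r s ^ 2 * hD - (l + 1) * a * lam s * hp
    rw [hκ]
    have e1 := hii s hs
    have e2 := h2' s hs
    have hq : deriv r s / r s * r s ^ 2 = r s * deriv r s := by field_simp
    have hinv : ((l : ℝ) + 1)⁻¹ * (l + 1) = 1 := inv_mul_cancel₀ (by positivity)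
    -- `hss` is the `ds²` component, from (ii) alone; `hxy` is the `N` component, from `hD'`, (ii)
    -- and the scalar curvature equation.
    have hss : ((l : ℝ) + 1) * (deriv r s / r s * deriv lam s) -
        lam s * ((l + 1) * deriv (deriv r) s / r s) = -1 := by
      field_simp at e1 ⊢
      linear_combination e1
    have hxy : -(deriv (deriv lam) s * r s ^ 2 + (l + 1) * (r s * deriv r s * deriv lam s)) +
        r s * deriv r s * deriv lam s - lam s * (l * κ - r s * deriv (deriv r) s -
          l * deriv r s ^ 2) - r s ^ 2 = 0 := by
      linear_combination -hD' - l * r s * e1 + lam s * e2 + r s ^ 2 * hinv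
    linear_combination -(b * c) * hss + h.inner x u v * hxy -
      (l + 1) * deriv lam s * h.inner x u v * hq
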